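/- For integers $k_1,\dots,k_r$ ($r\ge 1$) let $$\mathrm{Li}_{k_1,\dots,k_r}(z)=\sum_{0<m_1<\cdots<m_r}\frac{z^{m_r}}{m_1^{k_1}\cdots m_r^{k_r}}\qquad(|z|<1),$$ and denote by the same symbol its holomorphic continuation to $\mathbb C\setminus[1,\infty)$, whenever this exists. The multi-poly-Bernoulli numbers $B_m^{(k_1,\dots,k_r)}$ are defined by $$\frac{\mathrm{Li}_{k_1,\dots,k_r}(1-e^{-t})}{1-e^{-t}}=\sum_{m=0}^\infty B_m^{(k_1,\dots,k_r)}\frac{t^m}{m!}$$ for small $t\neq0$. Theorem. Let $r\ge 1$ and $n\ge 0$ be integers. Then $\mathrm{Li}_{1,\dots,1,-n}$ (with $r-1$ ones) continues holomorphically to $\mathbb C\setminus[1,\infty)$; the integral in $$\eta(\underbrace{1,\dots,1}_{r-1},-n;s)=\frac1{\Gamma(s)}\int_0^\infty \frac{t^{s-1}}{1-e^t}\,\mathrm{Li}_{\underbrace{\scriptstyle 1,\dots,1}_{r-1},-n}(1-e^t)\,dt$$ converges absolutely for $\Re(s)>0$; and the function $\eta(1,\dots,1,-n;s)$ so defined for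 $\Re(s)>0$ extends to an entire function of $s$, whose values at nonpositive integers are $$\eta(\underbrace{1,\dots,1}_{r-1},-n;-m)=B_m^{(\overbrace{\scriptstyle 1,\dots,1}^{r-1},-n)}\qquad(m\in\mathbb Z_{\ge0}).$$ -/

import Mathlib

open Filter Topology MeasureTheory

noncomputable section

/-- The index `(1, …, 1, -n)` with `d` entries equal to `1`, of depth `r = d + 1`. -/
def onesNegIndex (d n : ℕ) : Fin (d + 1) → ℤ :=
  Fin.snoc (fun _ : Fin d => (1 : ℤ)) (-(n : ℤ))

/-- The tuples `0 < m₁ < m₂ < ⋯ < m_r` of positive integers, where `r = d + 1`. -/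
def IncreasingTuple (d : ℕ) : Type :=
  {m : Fin (d + 1) → ℕ // 0 < m 0 ∧ StrictMono m}

/-- The term `z ^ m_r / (m₁ ^ k₁ ⋯ m_r ^ k_r)` of the multiple polylogarithm series. -/
def multiPolylogTerm {d : ℕ} (k : Fin (d + 1) → ℤ) (z : ℂ) (m : IncreasingTuple d) : ℂ :=
  z ^ (m.1 (Fin.last d)) / ∏ i, ((m.1 i : ℕ) : ℂ) ^ (k i)

/-- The cut plane `ℂ ∖ [1, ∞)`. -/
def cutPlane : Set ℂ := {z | 1 - z ∈ Complex.slitPlane}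

/-- `L` is the multiple polylogarithm `Li_k`: it is holomorphic on `ℂ ∖ [1, ∞)`, and on the
open unit disc it is the sum of the (absolutely convergent) series
`∑_{0 < m₁ < ⋯ < m_r} z ^ m_r / (m₁ ^ k₁ ⋯ m_r ^ k_r)`. -/
def IsMultiPolylog {d : ℕ} (k : Fin (d + 1) → ℤ) (L : ℂ → ℂ) : Prop :=
  DifferentiableOn ℂ L cutPlane ∧
    ∀ z : ℂ, ‖z‖ < 1 → HasSum (multiPolylogTerm k z) (L z)

/-- The multiple polylogarithm `Li_k` on `ℂ ∖ [1, ∞)`. -/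
def multiPolylog {d : ℕ} (k : Fin (d + 1) → ℤ) : ℂ → ℂ :=
  Classical.epsilon (IsMultiPolylog k)

/-- The integrand `t ^ (s - 1) * Li_k (1 - e ^ t) / (1 - e ^ t)`. -/
def etaIntegrand {d : ℕ} (k : Fin (d + 1) → ℤ) (s : ℂ) (t : ℝ) : ℂ :=
  (t : ℂ) ^ (s - 1) *
    (multiPolylog k (1 - Complex.exp (t : ℂ)) / (1 - Complex.exp (t : ℂ)))

/-- The function `η(k; s)` for `Re s > 0`, defined by its integral. -/
def etaIntegral {d : ℕ} (k : Fin (d + 1) → ℤ) (s : ℂ) : ℂ :=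
  1 / Complex.Gamma s * ∫ t in Set.Ioi (0 : ℝ), etaIntegrand k s t

/-- The multi-poly-Bernoulli number `B_m^{(k)}`: the `m`-th Taylor coefficient at `0`, times `m!`,
of `Li_k (1 - e ^ (-t)) / (1 - e ^ (-t))`. Here `dslope L 0 z` is `L z / z` with its removable
singularity at `z = 0` filled in (note that `Li_k 0 = 0`); see
`IsMultiPolylog.hasSum_multiPolyBernoulli` below for the generating function. -/
def multiPolyBernoulli {d : ℕ} (k : Fin (d + 1) → ℤ) (m : ℕ) : ℂ :=
  iteratedDeriv m (fun t : ℂ => dslope (multiPolylog k) 0 (1 - Complex.exp (-t))) 0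

theorem isOpen_cutPlane : IsOpen cutPlane :=
  Complex.isOpen_slitPlane.preimage (continuous_const.sub continuous_id)

theorem zero_mem_cutPlane : (0 : ℂ) ∈ cutPlane := by
  simp [cutPlane]

theorem isPreconnected_cutPlane : IsPreconnected cutPlane := by
  have h : cutPlane = (fun w : ℂ => 1 - w) '' Complex.slitPlane := by
    ext z
    constructor
    · intro hz
      exact ⟨1 - z, hz, by ring⟩
    · rintro ⟨w, hw, rfl⟩
      simpa [cutPlane] using hw
  rw [h]
  refine IsPreconnected.image ?_ _ (by fun_prop)
  exact (Complex.starConvex_one_slitPlane.isPathConnected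
    Complex.one_mem_slitPlane).isConnected.isPreconnected

/-- `Li_k` is uniquely determined on `ℂ ∖ [1, ∞)`. -/
theorem IsMultiPolylog.eqOn {d : ℕ} {k : Fin (d + 1) → ℤ} {L M : ℂ → ℂ}
    (hL : IsMultiPolylog k L) (hM : IsMultiPolylog k M) : Set.EqOn L M cutPlane := by
  refine (hL.1.analyticOnNhd isOpen_cutPlane).eqOn_of_preconnected_of_eventuallyEq
    (hM.1.analyticOnNhd isOpen_cutPlane) isPreconnected_cutPlane zero_mem_cutPlane ?_
  filter_upwards [Metric.ball_mem_nhds (0 : ℂ) one_pos] with z hz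
  have hz' : ‖z‖ < 1 := by simpa using hz
  exact (hL.2 z hz').unique (hM.2 z hz')

theorem IsMultiPolylog.map_zero {d : ℕ} {k : Fin (d + 1) → ℤ} {L : ℂ → ℂ}
    (hL : IsMultiPolylog k L) : L 0 = 0 := by
  refine (hL.2 0 (by simp)).unique ?_
  have h : multiPolylogTerm k 0 = fun _ => 0 := by
    funext m
    have hm : 0 < m.1 (Fin.last d) :=
      lt_of_lt_of_le m.2.1 (m.2.2.monotone (Fin.zero_le _))
    simp [multiPolylogTerm, hm.ne']
  rw [h]
  exact hasSum_zero

/-- The defining generating function of the multi-poly-Bernoulli numbers: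
`Li_k (1 - e ^ (-t)) / (1 - e ^ (-t)) = ∑ B_m^{(k)} t ^ m / m!` for small `t ≠ 0`. -/
theorem IsMultiPolylog.hasSum_multiPolyBernoulli {d : ℕ} {k : Fin (d + 1) → ℤ}
    (hL : IsMultiPolylog k (multiPolylog k)) :
    ∀ᶠ t : ℂ in 𝓝[≠] 0,
      HasSum (fun m : ℕ => multiPolyBernoulli k m * t ^ m / (m.factorial : ℂ))
        (multiPolylog k (1 - Complex.exp (-t)) / (1 - Complex.exp (-t))) := by
  set G : ℂ → ℂ := fun t => dslope (multiPolylog k) 0 (1 - Complex.exp (-t)) with hG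
  have hD : DifferentiableOn ℂ (dslope (multiPolylog k) 0) cutPlane :=
    (Complex.differentiableOn_dslope (isOpen_cutPlane.mem_nhds zero_mem_cutPlane)).2 hL.1
  have hφ : Continuous fun t : ℂ => 1 - Complex.exp (-t) := by fun_prop
  have hU : IsOpen ((fun t : ℂ => 1 - Complex.exp (-t)) ⁻¹' cutPlane) :=
    isOpen_cutPlane.preimage hφ
  have h0 : (0 : ℂ) ∈ (fun t : ℂ => 1 - Complex.exp (-t)) ⁻¹' cutPlane := by
    simpa using zero_mem_cutPlane
  have hGd : DifferentiableOn ℂ G ((fun t : ℂ => 1 - Complex.exp (-t)) ⁻¹' cutPlane) :=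
    hD.comp (Differentiable.differentiableOn (by fun_prop)) (fun t ht => ht)
  obtain ⟨ε, hε, hball⟩ := Metric.isOpen_iff.1 hU 0 h0
  have hne : ∀ᶠ t : ℂ in 𝓝[≠] 0, Complex.exp (-t) ≠ 1 := by
    have hder : HasDerivAt (fun t : ℂ => Complex.exp (-t)) (-1) 0 := by
      simpa using (hasDerivAt_neg (0 : ℂ)).cexp
    simpa using hder.eventually_ne (c := (1 : ℂ)) (by norm_num)
  filter_upwards [hne, mem_nhdsWithin_of_mem_nhds (Metric.ball_mem_nhds (0 : ℂ) hε)]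
    with t ht htb
  have hs := Complex.hasSum_taylorSeries_on_ball (hGd.mono hball) htb
  have hne' : (1 : ℂ) - Complex.exp (-t) ≠ 0 := sub_ne_zero.2 (Ne.symm ht)
  have hval : G t = multiPolylog k (1 - Complex.exp (-t)) / (1 - Complex.exp (-t)) := by
    simp only [hG]
    rw [dslope_of_ne _ hne', slope_def_field, hL.map_zero]
    simp
  rw [hval] at hs
  refine hs.congr_fun ?_
  intro m
  simp only [multiPolyBernoulli, sub_zero, smul_eq_mul, hG]
  ring

end

noncomputable section

/-- On the open unit disc, `f` is the sum of the power series with coefficients `c`. -/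
def HasDiscExpansion (c : ℕ → ℂ) (f : ℂ → ℂ) : Prop :=
  ∀ z : ℂ, ‖z‖ < 1 → HasSum (fun N => c N * z ^ N) (f z)

namespace HasDiscExpansion

variable {c b : ℕ → ℂ} {f g : ℂ → ℂ}

theorem congr (h : HasDiscExpansion c f) (hfg : ∀ z : ℂ, ‖z‖ < 1 → f z = g z) :
    HasDiscExpansion c g := fun z hz => hfg z hz ▸ h z hz

theorem hasFPowerSeriesOnBall (h : HasDiscExpansion c f) :
    HasFPowerSeriesOnBall f (FormalMultilinearSeries.ofScalars ℂ c) 0 1 := by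
  refine ⟨?_, one_pos, ?_⟩
  · refine le_of_forall_lt_imp_le_of_dense fun r hr => ?_
    lift r to NNReal using hr.ne_top
    have hr' : ‖((r : ℝ) : ℂ)‖ < 1 := by simpa using hr
    refine FormalMultilinearSeries.le_radius_of_summable _ ?_
    have := (h _ hr').summable.norm
    simpa [FormalMultilinearSeries.ofScalars_norm] using this
  · intro y hy
    have hy' : ‖y‖ < 1 := by
      rwa [← ENNReal.coe_one, Metric.eball_coe, NNReal.coe_one, mem_ball_zero_iff] at hy
    simpa [FormalMultilinearSeries.ofScalars_apply_eq, smul_eq_mul, mul_comm] using h y hy'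

theorem eq_coeff (hc : HasDiscExpansion c f) (hb : HasDiscExpansion b f) : c = b := by
  have h := hc.hasFPowerSeriesOnBall.hasFPowerSeriesAt.eq_formalMultilinearSeries
    hb.hasFPowerSeriesOnBall.hasFPowerSeriesAt
  exact (FormalMultilinearSeries.ofScalars_series_eq_iff ℂ c b).1 h

theorem of_differentiableOn (hf : DifferentiableOn ℂ f (Metric.ball 0 1)) :
    HasDiscExpansion (fun N => iteratedDeriv N f 0 / (N.factorial : ℂ)) f := by
  intro z hz
  have := Complex.hasSum_taylorSeries_on_ball hf (z := z) (by simpa using hz)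
  refine this.congr_fun fun N => ?_
  simp [div_eq_mul_inv]
  ring

/-- The Euler operator `z d/dz` multiplies the `N`-th coefficient by `N`. -/
theorem mul_deriv (h : HasDiscExpansion c f) (hf : DifferentiableOn ℂ f (Metric.ball 0 1)) :
    HasDiscExpansion (fun N => N * c N) (fun z => z * deriv f z) := by
  have hc := h.eq_coeff (of_differentiableOn hf)
  have hd := of_differentiableOn (hf.deriv Metric.isOpen_ball)
  intro z hz
  have h1 := (hd z hz).mul_left z
  rw [← hasSum_nat_add_iff' 1]
  simp only [Finset.range_one, Finset.sum_singleton, Nat.cast_zero, zero_mul, sub_zero]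
  refine h1.congr_fun fun N => ?_
  have hN : (N.factorial : ℂ) ≠ 0 := by exact_mod_cast N.factorial_ne_zero
  have hN' : (N : ℂ) + 1 ≠ 0 := by exact_mod_cast N.succ_ne_zero
  simp only [hc, iteratedDeriv_succ', Nat.factorial_succ]
  push_cast
  field_simp
  ring

theorem of_mul_deriv (h : HasDiscExpansion c fun z => z * deriv f z)
    (hf : DifferentiableOn ℂ f (Metric.ball 0 1)) (h0 : f 0 = 0) :
    HasDiscExpansion (fun N => c N / N) f := by
  have hT := of_differentiableOn hf
  have hc := h.eq_coeff (hT.mul_deriv hf)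
  convert hT using 1
  funext N
  rcases eq_or_ne N 0 with rfl | hN
  · simp [h0]
  · have : (N : ℂ) ≠ 0 := by exact_mod_cast hN
    rw [hc]
    field_simp

/-- Multiplication by `z / (1 - z)` takes partial sums of the coefficients. -/
theorem partialSum (h : HasDiscExpansion c f) :
    HasDiscExpansion (fun N => ∑ j ∈ Finset.range N, c j) (fun z => z / (1 - z) * f z) := by
  intro z hz
  have h1 := hasSum_sum_range_mul_of_summable_norm (h z hz).summable.norm
    (summable_norm_geometric_of_norm_lt_one hz)
  rw [(h z hz).tsum_eq, tsum_geometric_of_norm_lt_one hz] at h1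
  rw [← hasSum_nat_add_iff' 1]
  simp only [Finset.range_one, Finset.sum_singleton, Finset.range_zero, Finset.sum_empty, zero_mul,
    sub_zero]
  have h2 := h1.mul_left z
  rw [show z * (f z * (1 - z)⁻¹) = z / (1 - z) * f z by ring] at h2
  refine h2.congr_fun fun N => ?_
  rw [Finset.sum_mul, Finset.mul_sum]
  refine Finset.sum_congr rfl fun j hj => ?_
  have hj' : j ≤ N := Nat.lt_succ_iff.1 (Finset.mem_range.1 hj)
  rw [show N + 1 = j + (N - j) + 1 by omega]
  simp only [pow_succ, pow_add]
  ring

end HasDiscExpansion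

/-- The coefficients of `(-log (1 - z)) ^ d / d!`. -/
def logPowCoeff : ℕ → ℕ → ℝ
  | 0, N => if N = 0 then 1 else 0
  | d + 1, N => (∑ j ∈ Finset.range N, logPowCoeff d j) / N

/-- The coefficients `∑ 1 / (m₁ ⋯ m_d)` over `0 < m₁ < ⋯ < m_d < N` of `Li_{1, …, 1, 0}`. -/
def onesZeroCoeff (d N : ℕ) : ℝ := ∑ j ∈ Finset.range N, logPowCoeff d j

theorem onesZeroCoeff_zero (N : ℕ) : onesZeroCoeff 0 N = if 0 < N then 1 else 0 := by
  simp [onesZeroCoeff, logPowCoeff]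

theorem onesZeroCoeff_succ (d N : ℕ) :
    onesZeroCoeff (d + 1) N = ∑ j ∈ Finset.range N, onesZeroCoeff d j / j := rfl

theorem ball_subset_cutPlane : Metric.ball (0 : ℂ) 1 ⊆ cutPlane := by
  intro z hz
  have h := Complex.mem_slitPlane_of_norm_lt_one (z := -z) (by simpa using hz)
  simpa [cutPlane, sub_eq_add_neg] using h

/-- The function `-log (1 - z)`, so that `z = 1 - e ^ (-negLog z)`. -/
def negLog (z : ℂ) : ℂ := -Complex.log (1 - z)

theorem ne_zero_of_mem_cutPlane {z : ℂ} (hz : z ∈ cutPlane) : 1 - z ≠ 0 :=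
  Complex.slitPlane_ne_zero hz

theorem hasDerivAt_negLog {z : ℂ} (hz : z ∈ cutPlane) :
    HasDerivAt negLog (1 / (1 - z)) z := by
  have h := (((hasDerivAt_id z).const_sub 1).clog hz).neg
  convert! h using 1
  simp [neg_div]

theorem exp_negLog {z : ℂ} (hz : z ∈ cutPlane) : Complex.exp (negLog z) = 1 / (1 - z) := by
  rw [negLog, Complex.exp_neg, Complex.exp_log (ne_zero_of_mem_cutPlane hz), one_div]

theorem hasDiscExpansion_negLog_pow (d : ℕ) :
    HasDiscExpansion (fun N => (logPowCoeff d N : ℂ)) fun z => negLog z ^ d / (d.factorial : ℂ) := by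
  induction d with
  | zero =>
    intro z _
    simp only [logPowCoeff, pow_zero, Nat.factorial_zero, Nat.cast_one, div_one]
    convert hasSum_ite_eq 0 (1 : ℂ) using 2 with N
    split_ifs with h <;> simp [h]
  | succ d ih =>
    have hder : ∀ z ∈ cutPlane, HasDerivAt (fun z => negLog z ^ (d + 1) / ((d + 1).factorial : ℂ))
        (1 / (1 - z) * (negLog z ^ d / (d.factorial : ℂ))) z := by
      intro z hz
      have h := ((hasDerivAt_negLog hz).pow (d + 1)).div_const ((d + 1).factorial : ℂ)
      convert! h using 1
      have hd : (d.factorial : ℂ) ≠ 0 := by exact_mod_cast d.factorial_ne_zero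
      have hd' : (d : ℂ) + 1 ≠ 0 := by exact_mod_cast d.succ_ne_zero
      have := ne_zero_of_mem_cutPlane hz
      rw [Nat.factorial_succ]
      push_cast
      field_simp
    have h1 := ih.partialSum.congr (g := fun z => z * deriv
        (fun z => negLog z ^ (d + 1) / ((d + 1).factorial : ℂ)) z) fun z hz => by
      rw [(hder z (ball_subset_cutPlane (by simpa using hz))).deriv]
      ring
    convert h1.of_mul_deriv (fun z hz => (hder z
      (ball_subset_cutPlane hz)).differentiableAt.differentiableWithinAt) (by simp [negLog]) using 1
    funext N
    simp [logPowCoeff]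

theorem hasDiscExpansion_onesZero (d : ℕ) :
    HasDiscExpansion (fun N => (onesZeroCoeff d N : ℂ))
      fun z => z / (1 - z) * (negLog z ^ d / (d.factorial : ℂ)) := by
  convert (hasDiscExpansion_negLog_pow d).partialSum using 1
  funext N
  simp [onesZeroCoeff]

/-- The entire functions `F` with `Li_{1, …, 1, -n} (1 - e ^ (-u)) = (1 - e ^ (-u)) * F u`. -/
def polylogQuotient (d : ℕ) : ℕ → ℂ → ℂ
  | 0, u => Complex.exp u * (u ^ d / (d.factorial : ℂ))
  | n + 1, u => polylogQuotient d n u + (Complex.exp u - 1) * deriv (polylogQuotient d n) u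

theorem differentiable_polylogQuotient (d n : ℕ) : Differentiable ℂ (polylogQuotient d n) := by
  induction n with
  | zero =>
    change Differentiable ℂ fun u => Complex.exp u * (u ^ d / (d.factorial : ℂ))
    fun_prop
  | succ n ih =>
    have := (ih.contDiff (n := 2)).differentiable_deriv_two
    change Differentiable ℂ fun u =>
      polylogQuotient d n u + (Complex.exp u - 1) * deriv (polylogQuotient d n) u
    fun_prop

/-- The holomorphic continuation of `Li_{1, …, 1, -n}` to the cut plane. -/
def onesNegPolylog (d n : ℕ) (z : ℂ) : ℂ := z * polylogQuotient d n (negLog z)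

theorem hasDerivAt_onesNegPolylog (d n : ℕ) {z : ℂ} (hz : z ∈ cutPlane) :
    HasDerivAt (onesNegPolylog d n)
      (polylogQuotient d n (negLog z) +
        z * (deriv (polylogQuotient d n) (negLog z) * (1 / (1 - z)))) z := by
  have h := (hasDerivAt_id z).mul
    (((differentiable_polylogQuotient d n (negLog z)).hasDerivAt).comp z (hasDerivAt_negLog hz))
  convert! h using 1
  simp

theorem onesNegPolylog_succ (d n : ℕ) {z : ℂ} (hz : z ∈ cutPlane) :
    onesNegPolylog d (n + 1) z = z * deriv (onesNegPolylog d n) z := by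
  rw [(hasDerivAt_onesNegPolylog d n hz).deriv, onesNegPolylog, polylogQuotient, exp_negLog hz]
  have := ne_zero_of_mem_cutPlane hz
  field_simp
  ring

theorem differentiableOn_onesNegPolylog (d n : ℕ) :
    DifferentiableOn ℂ (onesNegPolylog d n) cutPlane := fun _ hz =>
  (hasDerivAt_onesNegPolylog d n hz).differentiableAt.differentiableWithinAt

theorem hasDiscExpansion_onesNegPolylog (d n : ℕ) :
    HasDiscExpansion (fun N => (N : ℂ) ^ n * onesZeroCoeff d N) (onesNegPolylog d n) := by
  induction n with
  | zero =>
    simp only [pow_zero, one_mul]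
    refine (hasDiscExpansion_onesZero d).congr fun z hz => ?_
    rw [onesNegPolylog, polylogQuotient, exp_negLog (ball_subset_cutPlane (by simpa using hz))]
    ring
  | succ n ih =>
    have h := ih.mul_deriv ((differentiableOn_onesNegPolylog d n).mono ball_subset_cutPlane)
    convert h.congr (g := onesNegPolylog d (n + 1)) fun z hz =>
      (onesNegPolylog_succ d n (ball_subset_cutPlane (by simpa using hz))).symm using 1
    funext N
    ring

/-- Summation by fibres: if the nonnegative weights `w` sum to `c N` over each fibre of `p`, then
a function of `p x`, weighted by `w x`, sums to `∑ g N * c N`. -/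
theorem hasSum_comp_mul_of_fiber {T : Type*} {p : T → ℕ} {w : T → ℝ} {c : ℕ → ℝ} (hw : ∀ x, 0 ≤ w x)
    (hfib : ∀ N, HasSum (fun x : {x // p x = N} => w x) (c N)) {g : ℕ → ℂ} {a : ℂ}
    (hg : HasSum (fun N => g N * c N) a) :
    HasSum (fun x => g (p x) * (w x : ℂ)) a := by
  have hc : ∀ N, 0 ≤ c N := fun N => hasSum_le (fun x : {x // p x = N} => hw x) hasSum_zero (hfib N)
  rw [← (Equiv.sigmaFiberEquiv p).hasSum_iff]
  have hinner : ∀ N, HasSum (fun x : {x // p x = N} => g (p x) * (w x : ℂ)) (g N * c N) := by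
    intro N
    refine ((Complex.hasSum_ofReal.2 (hfib N)).mul_left (g N)).congr_fun fun x => ?_
    rw [x.2]
  have hsum : Summable ((fun x => g (p x) * (w x : ℂ)) ∘ Equiv.sigmaFiberEquiv p) := by
    refine Summable.of_norm ?_
    refine (summable_sigma_of_nonneg fun _ => norm_nonneg _).2
      ⟨fun N => (hinner N).summable.norm, hg.summable.norm.congr fun N => ?_⟩
    have h : HasSum (fun x : {x // p x = N} => ‖g (p x) * (w x : ℂ)‖) (‖g N‖ * c N) := by
      refine ((hfib N).mul_left ‖g N‖).congr_fun fun x => ?_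
      rw [norm_mul, Complex.norm_real, Real.norm_of_nonneg (hw x), x.2]
    rw [norm_mul, Complex.norm_real, Real.norm_of_nonneg (hc N)]
    exact h.tsum_eq.symm
  have h1 := hsum.hasSum.sigma hinner
  rw [hg.unique h1]
  exact hsum.hasSum

namespace IncreasingTuple

/-- The largest entry of an increasing tuple. -/
def last {d : ℕ} (m : IncreasingTuple d) : ℕ := m.1 (Fin.last d)

/-- The product of the reciprocals of all entries but the largest. -/
def weight {d : ℕ} (m : IncreasingTuple d) : ℝ := ∏ i : Fin d, ((m.1 i.castSucc : ℕ) : ℝ)⁻¹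

theorem weight_nonneg {d : ℕ} (m : IncreasingTuple d) : 0 ≤ m.weight :=
  Finset.prod_nonneg fun _ _ => by positivity

theorem snoc_increasing {d N : ℕ} {f : Fin (d + 1) → ℕ} (hf : 0 < f 0 ∧ StrictMono f)
    (hN : f (Fin.last d) < N) :
    0 < (Fin.snoc f N : Fin (d + 2) → ℕ) 0 ∧ StrictMono (Fin.snoc f N : Fin (d + 2) → ℕ) := by
  constructor
  · rw [← Fin.castSucc_zero, Fin.snoc_castSucc (α := fun _ => ℕ)]
    exact hf.1
  · rw [Fin.strictMono_iff_lt_succ]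
    intro i
    rw [Fin.snoc_castSucc (α := fun _ => ℕ)]
    refine Fin.lastCases ?_ (fun j => ?_) i
    · rw [Fin.succ_last, Fin.snoc_last (α := fun _ => ℕ)]
      exact hN
    · rw [Fin.succ_castSucc, Fin.snoc_castSucc (α := fun _ => ℕ)]
      exact hf.2 Fin.castSucc_lt_succ

/-- Appending the entry `N` to the increasing tuples whose entries are smaller than `N`. -/
def snocEquiv (d N : ℕ) :
    {m : IncreasingTuple d // m.last < N} ≃ {m : IncreasingTuple (d + 1) // m.last = N} where
  toFun m := ⟨⟨(Fin.snoc m.1.1 N : Fin (d + 2) → ℕ), snoc_increasing m.1.2 m.2⟩,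
    Fin.snoc_last (α := fun _ => ℕ) N m.1.1⟩
  invFun m := ⟨⟨fun i => m.1.1 i.castSucc, m.1.2.1, fun i j hij =>
    m.1.2.2 (Fin.castSucc_lt_castSucc_iff.2 hij)⟩,
    (m.1.2.2 (Fin.castSucc_lt_last (Fin.last d))).trans_eq m.2⟩
  left_inv m := Subtype.ext (Subtype.ext (funext fun i =>
    Fin.snoc_castSucc (α := fun _ => ℕ) N m.1.1 i))
  right_inv m := by
    obtain ⟨m, rfl⟩ := m
    exact Subtype.ext (Subtype.ext (Fin.snoc_init_self m.1))

theorem weight_snocEquiv {d N : ℕ} (m : {m : IncreasingTuple d // m.last < N}) :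
    (snocEquiv d N m).1.weight = m.1.weight * ((m.1.last : ℕ) : ℝ)⁻¹ := by
  have h : ∀ i : Fin (d + 1), (snocEquiv d N m).1.1 i.castSucc = m.1.1 i := fun i =>
    Fin.snoc_castSucc (α := fun _ => ℕ) N m.1.1 i
  rw [weight, Fin.prod_univ_castSucc]
  simp only [h]
  rfl

theorem hasSum_weight_fiber (d N : ℕ) :
    HasSum (fun m : {m : IncreasingTuple d // m.last = N} => m.1.weight) (onesZeroCoeff d N) := by
  induction d generalizing N with
  | zero =>
    rw [onesZeroCoeff_zero]
    split_ifs with h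
    · let _ : Unique {m : IncreasingTuple 0 // m.last = N} :=
        { default := ⟨⟨fun _ => N, h, fun i j hij => absurd hij (by omega)⟩, rfl⟩
          uniq := fun m => Subtype.ext (Subtype.ext (funext fun i =>
            (congrArg m.1.1 (by omega : i = Fin.last 0)).trans m.2)) }
      have h1 := hasSum_unique fun m : {m : IncreasingTuple 0 // m.last = N} => m.1.weight
      simpa only [weight, Finset.univ_eq_empty, Finset.prod_empty] using h1
    · have : IsEmpty {m : IncreasingTuple 0 // m.last = N} :=
        ⟨fun m => h (m.2 ▸ m.1.2.1)⟩
      exact hasSum_empty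
  | succ d ih =>
    have hg : HasSum (fun j => (if j < N then (j : ℂ)⁻¹ else 0) * (onesZeroCoeff d j : ℂ))
        (onesZeroCoeff (d + 1) N : ℂ) := by
      have h := hasSum_sum_of_ne_finset_zero (L := .unconditional ℕ) (s := Finset.range N)
        (f := fun j => (if j < N then (j : ℂ)⁻¹ else 0) * (onesZeroCoeff d j : ℂ))
        fun j hj => by simp [Finset.mem_range.not.1 hj]
      convert h using 1
      rw [onesZeroCoeff_succ]
      push_cast
      refine Finset.sum_congr rfl fun j hj => ?_
      rw [if_pos (Finset.mem_range.1 hj)]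
      ring
    have h := hasSum_comp_mul_of_fiber weight_nonneg ih hg
    rw [← (snocEquiv d N).hasSum_iff]
    refine Complex.hasSum_ofReal.1 ?_
    have h2 : HasSum (Set.indicator {m : IncreasingTuple d | m.last < N}
        fun m => ((m.weight * (m.last : ℝ)⁻¹ : ℝ) : ℂ)) (onesZeroCoeff (d + 1) N : ℂ) := by
      refine h.congr_fun fun m => ?_
      by_cases hm : m.last < N <;> simp [Set.indicator, hm, mul_comm]
    refine (hasSum_subtype_iff_indicator.2 h2).congr_fun fun m => ?_
    exact congrArg _ (weight_snocEquiv m)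

end IncreasingTuple

theorem multiPolylogTerm_onesNegIndex (d n : ℕ) (z : ℂ) (m : IncreasingTuple d) :
    multiPolylogTerm (onesNegIndex d n) z m =
      ((m.last : ℂ) ^ n * z ^ m.last) * (m.weight : ℂ) := by
  rw [multiPolylogTerm, Fin.prod_univ_castSucc]
  simp only [onesNegIndex, Fin.snoc_castSucc, Fin.snoc_last, zpow_one, zpow_neg, zpow_natCast,
    IncreasingTuple.last, IncreasingTuple.weight, Complex.ofReal_prod, Complex.ofReal_inv,
    Complex.ofReal_natCast, Finset.prod_inv_distrib, div_eq_mul_inv, mul_inv, inv_inv]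
  ring

theorem isMultiPolylog_onesNegPolylog (d n : ℕ) :
    IsMultiPolylog (onesNegIndex d n) (onesNegPolylog d n) := by
  refine ⟨differentiableOn_onesNegPolylog d n, fun z hz => ?_⟩
  have h := hasDiscExpansion_onesNegPolylog d n z hz
  refine (hasSum_comp_mul_of_fiber (g := fun N : ℕ => (N : ℂ) ^ n * z ^ N)
    IncreasingTuple.weight_nonneg (IncreasingTuple.hasSum_weight_fiber d)
    (h.congr_fun fun N => by ring)).congr_fun fun m => multiPolylogTerm_onesNegIndex d n z m

theorem isMultiPolylog_multiPolylog (d n : ℕ) :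
    IsMultiPolylog (onesNegIndex d n) (multiPolylog (onesNegIndex d n)) :=
  Classical.epsilon_spec (p := IsMultiPolylog (onesNegIndex d n))
    ⟨_, isMultiPolylog_onesNegPolylog d n⟩

theorem multiPolylog_eq {d n : ℕ} {z : ℂ} (hz : z ∈ cutPlane) :
    multiPolylog (onesNegIndex d n) z = onesNegPolylog d n z :=
  (isMultiPolylog_multiPolylog d n).eqOn (isMultiPolylog_onesNegPolylog d n) hz

/-- The functions `u ^ a * e ^ ((b + 1) * u)`. -/
def powMulExp (p : ℕ × ℕ) (u : ℂ) : ℂ := u ^ p.1 * Complex.exp ((p.2 + 1) * u)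

/-- The linear span of the functions `u ^ a * e ^ ((b + 1) * u)`. -/
def expPolynomial : Submodule ℂ (ℂ → ℂ) := Submodule.span ℂ (Set.range powMulExp)

theorem powMulExp_mem (p : ℕ × ℕ) : powMulExp p ∈ expPolynomial :=
  Submodule.subset_span ⟨p, rfl⟩

theorem differentiable_powMulExp (p : ℕ × ℕ) : Differentiable ℂ (powMulExp p) := by
  unfold powMulExp
  fun_prop

theorem differentiable_of_mem_expPolynomial {F : ℂ → ℂ} (hF : F ∈ expPolynomial) :
    Differentiable ℂ F := by
  induction hF using Submodule.span_induction with
  | mem F hF => obtain ⟨p, rfl⟩ := hF; exact differentiable_powMulExp p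
  | zero => exact differentiable_const 0
  | add F G _ _ hF hG => exact hF.add hG
  | smul c F _ hF => exact hF.const_smul c

theorem exp_mul_mem_expPolynomial {F : ℂ → ℂ} (hF : F ∈ expPolynomial) :
    (fun u => Complex.exp u * F u) ∈ expPolynomial := by
  induction hF using Submodule.span_induction with
  | mem F hF =>
    obtain ⟨p, rfl⟩ := hF
    convert powMulExp_mem (p.1, p.2 + 1) using 1
    funext u
    simp only [powMulExp]
    push_cast
    rw [show ((p.2 : ℂ) + 1 + 1) * u = u + (p.2 + 1) * u by ring, Complex.exp_add]
    ring
  | zero =>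
    convert expPolynomial.zero_mem using 1
    funext u
    simp
  | add F G _ _ hF hG =>
    convert expPolynomial.add_mem hF hG using 1
    funext u
    simp [mul_add]
  | smul c F _ hF =>
    convert expPolynomial.smul_mem c hF using 1
    funext u
    simp
    ring

theorem deriv_powMulExp (p : ℕ × ℕ) :
    deriv (powMulExp p) =
      (p.1 : ℂ) • powMulExp (p.1 - 1, p.2) + ((p.2 : ℂ) + 1) • powMulExp p := by
  funext u
  have h := (hasDerivAt_pow p.1 u).mul (((hasDerivAt_id u).const_mul ((p.2 : ℂ) + 1)).cexp)
  refine (HasDerivAt.deriv (f := powMulExp p) h).trans ?_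
  simp [powMulExp]
  ring

theorem deriv_mem_expPolynomial {F : ℂ → ℂ} (hF : F ∈ expPolynomial) :
    deriv F ∈ expPolynomial := by
  induction hF using Submodule.span_induction with
  | mem F hF =>
    obtain ⟨p, rfl⟩ := hF
    rw [deriv_powMulExp]
    exact expPolynomial.add_mem (expPolynomial.smul_mem _ (powMulExp_mem _))
      (expPolynomial.smul_mem _ (powMulExp_mem _))
  | zero =>
    have : deriv (0 : ℂ → ℂ) = 0 := deriv_zero
    rw [this]
    exact expPolynomial.zero_mem
  | add F G hF' hG' hF hG =>
    convert expPolynomial.add_mem hF hG using 1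
    funext u
    exact deriv_add (differentiable_of_mem_expPolynomial hF' u)
      (differentiable_of_mem_expPolynomial hG' u)
  | smul c F hF' hF =>
    convert expPolynomial.smul_mem c hF using 1
    funext u
    exact deriv_const_smul c (differentiable_of_mem_expPolynomial hF' u)

theorem polylogQuotient_mem_expPolynomial (d n : ℕ) : polylogQuotient d n ∈ expPolynomial := by
  induction n with
  | zero =>
    convert expPolynomial.smul_mem ((d.factorial : ℂ)⁻¹) (powMulExp_mem (d, 0)) using 1
    funext u
    simp [polylogQuotient, powMulExp]
    ring
  | succ n ih =>
    have h := deriv_mem_expPolynomial ih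
    convert expPolynomial.add_mem ih (expPolynomial.sub_mem (exp_mul_mem_expPolynomial h) h)
      using 1
    funext u
    simp [polylogQuotient]
    ring

/-- `F` is entire and `1 / Γ(s) * ∫ t ^ (s - 1) * F (-t)` over `t > 0` converges absolutely for
`Re s > 0` and extends to an entire function with values `F⁽ᵐ⁾(0)` at `-m`. -/
def HasEntireMellin (F : ℂ → ℂ) : Prop :=
  Differentiable ℂ F ∧
  (∀ s : ℂ, 0 < s.re →
    IntegrableOn (fun t : ℝ => (t : ℂ) ^ (s - 1) * F (-(t : ℂ))) (Set.Ioi 0)) ∧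
  ∃ η : ℂ → ℂ, Differentiable ℂ η ∧
    (∀ s : ℂ, 0 < s.re → η s =
      1 / Complex.Gamma s * ∫ t in Set.Ioi (0 : ℝ), (t : ℂ) ^ (s - 1) * F (-(t : ℂ))) ∧
    ∀ m : ℕ, η (-(m : ℂ)) = iteratedDeriv m F 0

theorem HasEntireMellin.zero : HasEntireMellin 0 := by
  refine ⟨differentiable_const 0, fun s _ => by simp, fun _ => 0, differentiable_const 0,
    fun s _ => by simp, fun m => ?_⟩
  have h : iteratedDeriv m (fun _ : ℂ => (0 : ℂ)) 0 = 0 := by simp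
  exact h.symm

theorem HasEntireMellin.add {F G : ℂ → ℂ} (hF : HasEntireMellin F) (hG : HasEntireMellin G) :
    HasEntireMellin (F + G) := by
  obtain ⟨dF, iF, η, dη, eη, vη⟩ := hF
  obtain ⟨dG, iG, θ, dθ, eθ, vθ⟩ := hG
  refine ⟨dF.add dG, fun s hs => ?_, η + θ, dη.add dθ, fun s hs => ?_, fun m => ?_⟩
  · simp only [Pi.add_apply, mul_add]
    exact (iF s hs).add (iG s hs)
  · simp only [Pi.add_apply, mul_add, eη s hs, eθ s hs]
    rw [integral_add (iF s hs) (iG s hs), mul_add]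
  · rw [iteratedDeriv_add dF.contDiff.contDiffAt dG.contDiff.contDiffAt, Pi.add_apply, vη, vθ]

theorem HasEntireMellin.smul {F : ℂ → ℂ} (c : ℂ) (hF : HasEntireMellin F) :
    HasEntireMellin (c • F) := by
  obtain ⟨dF, iF, η, dη, eη, vη⟩ := hF
  refine ⟨dF.const_smul c, fun s hs => ?_, c • η, dη.const_smul c, fun s hs => ?_, fun m => ?_⟩
  · simp only [Pi.smul_apply, mul_smul_comm]
    exact (iF s hs).smul c
  · simp only [Pi.smul_apply, mul_smul_comm, eη s hs]
    rw [integral_smul, mul_smul_comm]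
  · rw [iteratedDeriv_const_smul_field, Pi.smul_apply, vη]

theorem iteratedDeriv_id_mul_zero {g : ℂ → ℂ} (hg : Differentiable ℂ g) (m : ℕ) :
    iteratedDeriv m (fun u => u * g u) 0 = m * iteratedDeriv (m - 1) g 0 := by
  rw [iteratedDeriv_fun_mul (by fun_prop) hg.contDiff.contDiffAt]
  simp only [iteratedDeriv_fun_id_zero]
  rcases m with _ | m
  · simp
  · rw [Finset.sum_eq_single 1 (fun i _ hi => by simp [hi]) (fun h => by simp at h)]
    simp

theorem iteratedDeriv_powMulExp_zero (a b m : ℕ) :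
    iteratedDeriv m (powMulExp (a, b)) 0 =
      (m.descFactorial a : ℂ) * ((b : ℂ) + 1) ^ (m - a) := by
  induction a generalizing m with
  | zero =>
    have h : powMulExp (0, b) = fun u => Complex.exp (((b : ℂ) + 1) * u) := by
      funext u
      simp [powMulExp]
    rw [h, iteratedDeriv_cexp_const_mul]
    simp
  | succ a ih =>
    have h : powMulExp (a + 1, b) = fun u => u * powMulExp (a, b) u := by
      funext u
      simp [powMulExp]
      ring
    rw [h, iteratedDeriv_id_mul_zero (differentiable_powMulExp _), ih]
    rcases m with _ | m
    · simp
    · rw [Nat.succ_descFactorial_succ, Nat.add_sub_cancel, Nat.add_sub_add_right]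
      push_cast
      ring

theorem ascPochhammer_eval_neg_natCast (a m : ℕ) :
    (ascPochhammer ℂ a).eval (-(m : ℂ)) = (-1) ^ a * (m.descFactorial a : ℂ) := by
  rw [ascPochhammer_eval_neg_eq_descPochhammer, descPochhammer_eval_eq_descFactorial]

theorem hasEntireMellin_powMulExp (p : ℕ × ℕ) : HasEntireMellin (powMulExp p) := by
  obtain ⟨a, b⟩ := p
  have hb : (0 : ℝ) < b + 1 := by positivity
  have hb' : (1 / (((b + 1 : ℝ)) : ℂ)) ≠ 0 :=
    one_div_ne_zero (Complex.ofReal_ne_zero.2 hb.ne')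
  have hint : ∀ s : ℂ, ∀ t ∈ Set.Ioi (0 : ℝ),
      (t : ℂ) ^ (s - 1) * powMulExp (a, b) (-(t : ℂ)) =
        (-1) ^ a * ((t : ℂ) ^ (s + a - 1) * Complex.exp (-(((b + 1 : ℝ) : ℂ) * t))) := by
    intro s t ht
    have ht' : (t : ℂ) ≠ 0 := Complex.ofReal_ne_zero.2 (ne_of_gt ht)
    rw [show s + a - 1 = s - 1 + a by ring, Complex.cpow_add _ _ ht', Complex.cpow_natCast,
      powMulExp, neg_pow]
    push_cast
    rw [mul_neg]
    ring
  have hre : ∀ s : ℂ, 0 < s.re → 0 < (s + a).re := fun s hs => by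
    rw [Complex.add_re, Complex.natCast_re]
    positivity
  refine ⟨differentiable_powMulExp _, fun s hs => ?_, fun s => (-1) ^ a *
    ((1 / ((b + 1 : ℝ) : ℂ)) ^ (s + a) * (ascPochhammer ℂ a).eval s), ?_, fun s hs => ?_,
    fun m => ?_⟩
  · refine IntegrableOn.congr_fun (Integrable.const_mul ?_ _) (fun t ht => (hint s t ht).symm)
      measurableSet_Ioi
    refine Integrable.of_integral_ne_zero ?_
    rw [Complex.integral_cpow_mul_exp_neg_mul_Ioi (hre s hs) hb]
    exact mul_ne_zero (mt (fun h => (Complex.cpow_eq_zero_iff _ _).1 h |>.1) hb')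
      (Complex.Gamma_ne_zero_of_re_pos (hre s hs))
  · refine (differentiable_const _).mul (Differentiable.mul ?_ (Polynomial.differentiable _))
    exact (differentiable_id.add_const _).const_cpow (Or.inl hb')
  · beta_reduce
    rw [setIntegral_congr_fun measurableSet_Ioi (hint s), integral_const_mul,
      Complex.integral_cpow_mul_exp_neg_mul_Ioi (hre s hs) hb, ← Complex.Gamma_add_nat_div_Gamma_eq]
    · ring
    · rintro k rfl
      simp at hs
      exact absurd hs (not_lt.2 (Nat.cast_nonneg k))
  · beta_reduce
    rw [iteratedDeriv_powMulExp_zero, ascPochhammer_eval_neg_natCast]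
    rcases lt_or_ge m a with h | h
    · simp [Nat.descFactorial_of_lt h]
    · rw [show -(m : ℂ) + a = -((m - a : ℕ) : ℂ) by push_cast [h]; ring, Complex.cpow_neg,
        Complex.cpow_natCast]
      have h1 : ((-1 : ℂ)) ^ a * (-1) ^ a = 1 := by rw [← mul_pow]; simp
      push_cast
      rw [one_div, inv_pow, inv_inv]
      linear_combination (((b : ℂ) + 1) ^ (m - a) * (m.descFactorial a : ℂ)) * h1

theorem hasEntireMellin_of_mem_expPolynomial {F : ℂ → ℂ} (hF : F ∈ expPolynomial) :
    HasEntireMellin F := by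
  induction hF using Submodule.span_induction with
  | mem F hF => obtain ⟨p, rfl⟩ := hF; exact hasEntireMellin_powMulExp p
  | zero => exact HasEntireMellin.zero
  | add F G _ _ hF hG => exact hF.add hG
  | smul c F _ hF => exact hF.smul c

theorem negLog_one_sub_exp_ofReal (t : ℝ) : negLog (1 - Complex.exp (t : ℂ)) = -(t : ℂ) := by
  rw [negLog, sub_sub_cancel, ← Complex.ofReal_exp, ← Complex.ofReal_log (Real.exp_pos t).le,
    Real.log_exp]

theorem etaIntegrand_eq (d n : ℕ) (s : ℂ) {t : ℝ} (ht : t ∈ Set.Ioi (0 : ℝ)) :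
    etaIntegrand (onesNegIndex d n) s t =
      (t : ℂ) ^ (s - 1) * polylogQuotient d n (-(t : ℂ)) := by
  have hmem : 1 - Complex.exp (t : ℂ) ∈ cutPlane := by
    change 1 - (1 - Complex.exp (t : ℂ)) ∈ Complex.slitPlane
    rw [sub_sub_cancel, ← Complex.ofReal_exp]
    exact Complex.ofReal_mem_slitPlane.2 (Real.exp_pos t)
  have hne : 1 - Complex.exp (t : ℂ) ≠ 0 := by
    rw [← Complex.ofReal_exp, ← Complex.ofReal_one, ← Complex.ofReal_sub]
    exact Complex.ofReal_ne_zero.2 (sub_ne_zero.2 (Real.one_lt_exp_iff.2 ht).ne)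
  rw [etaIntegrand, multiPolylog_eq hmem, onesNegPolylog, mul_div_cancel_left₀ _ hne,
    negLog_one_sub_exp_ofReal]

theorem dslope_multiPolylog {d n : ℕ} {z : ℂ} (hz : z ∈ cutPlane) :
    dslope (multiPolylog (onesNegIndex d n)) 0 z = polylogQuotient d n (negLog z) := by
  rcases eq_or_ne z 0 with rfl | hne
  · have h : multiPolylog (onesNegIndex d n) =ᶠ[𝓝 0] onesNegPolylog d n := by
      filter_upwards [isOpen_cutPlane.mem_nhds hz] with z hz using multiPolylog_eq hz
    rw [dslope_same, h.deriv_eq, (hasDerivAt_onesNegPolylog d n hz).deriv]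
    simp
  · rw [dslope_of_ne _ hne, slope_def_field, (isMultiPolylog_multiPolylog d n).map_zero,
      multiPolylog_eq hz, onesNegPolylog]
    rw [sub_zero, sub_zero, mul_div_cancel_left₀ _ hne]

theorem multiPolyBernoulli_eq (d n m : ℕ) :
    multiPolyBernoulli (onesNegIndex d n) m = iteratedDeriv m (polylogQuotient d n) 0 := by
  refine Filter.EventuallyEq.iteratedDeriv_eq m ?_
  have hc : Continuous fun t : ℂ => 1 - Complex.exp (-t) := by fun_prop
  have h1 : ∀ᶠ t : ℂ in 𝓝 0, 1 - Complex.exp (-t) ∈ cutPlane :=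
    hc.continuousAt.eventually_mem (isOpen_cutPlane.mem_nhds (by simpa using zero_mem_cutPlane))
  filter_upwards [h1, Metric.ball_mem_nhds (0 : ℂ) Real.pi_pos] with t ht htb
  have him : |(-t).im| < Real.pi := (Complex.abs_im_le_norm _).trans_lt (by simpa using htb)
  rw [dslope_multiPolylog ht, negLog, sub_sub_cancel,
    Complex.log_exp (abs_lt.1 him).1 (abs_lt.1 him).2.le, neg_neg]

end

theorem mainTheorem8 (d n : ℕ) :
    IsMultiPolylog (onesNegIndex d n) (multiPolylog (onesNegIndex d n)) ∧
    (∀ s : ℂ, 0 < s.re →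
      IntegrableOn (etaIntegrand (onesNegIndex d n) s) (Set.Ioi (0 : ℝ))) ∧
    ∃ η : ℂ → ℂ, Differentiable ℂ η ∧
      (∀ s : ℂ, 0 < s.re → η s = etaIntegral (onesNegIndex d n) s) ∧
      ∀ m : ℕ, η (-(m : ℂ)) = multiPolyBernoulli (onesNegIndex d n) m := by
  obtain ⟨-, hI, η, hd, he, hv⟩ :=
    hasEntireMellin_of_mem_expPolynomial (polylogQuotient_mem_expPolynomial d n)
  refine ⟨isMultiPolylog_multiPolylog d n, fun s hs => ?_, η, hd, fun s hs => ?_, fun m => ?_⟩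
  · exact (hI s hs).congr_fun (fun t ht => (etaIntegrand_eq d n s ht).symm) measurableSet_Ioi
  · rw [he s hs, etaIntegral,
      setIntegral_congr_fun measurableSet_Ioi fun t ht => etaIntegrand_eq d n s ht]
  · rw [hv, multiPolyBernoulli_eq]
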